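/- All linear orders are assumed non-empty. For linear orders $L,M$, an embedding of $L$ into $M$ is an order preserving injection $L\to M$, and an epimorphism of $M$ onto $L$ is an order preserving ($x\le y\Rightarrow f(x)\le f(y)$) surjection $M\to L$. A linear order $M$ is strongly surjective if for every linear order $L$ that embeds into $M$ there is an epimorphism of $M$ onto $L$; it is scattered if $\mathbb Q$ does not embed into it. Let $\mathsf{Lin}\subseteq 2^{\mathbb N\times\mathbb N}$ be the space of all linear orders on non-empty subsets of $\mathbb N$, with the subspace topology, and let $\mathsf{StS}$ and $\mathsf{Scat}$ be the sets of strongly surjective, respectively scattered, elements of $\mathsf{Lin}$. A subset $B$ of a Polish space $Y$ is $\mathbf{\Sigma}^1_1$-hard if for every zero-dimensional Polish space $X$ and every analytic $A\subseteq X$ there is a continuous $f:X\to Y$ with $A=f^{-1}(B)$ (a continuous reduction of $A$ to $B$), and $\mathbf{\Sigma}^1_1$-complete if moreover it is analytic. A subset of $2^{\mathbb N\times\mathbb N}$ is (lightface) $\Sigma^1_1$ if it is the projection of a (lightface) $\Pi^0_1$ subset of $2^{\mathbb N\times\mathbb N}\times\mathbb N^{\mathbb N}$, that is, of the complement of a recursively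 enumerable union of basic open sets. **Proposition.** The set $\mathsf{StS}$ is $\mathbf{\Sigma}^1_1$-hard. The set $\mathsf{StS}\setminus\mathsf{Scat}$ of non-scattered countable strongly surjective orders is (lightface) $\Sigma^1_1$ and $\mathbf{\Sigma}^1_1$-complete. Moreover the map $\mathsf{Lin}\to\mathsf{Lin}$, $L\mapsto\eta+L\omega$ (a copy of $\mathbb Q$ followed by $\omega$ consecutive copies of $L$, implemented on $\mathbb N$ by a fixed standard recursive coding), is continuous and reduces $\mathsf{Lin}\setminus\mathsf{Scat}$ both to $\mathsf{StS}$ and to $\mathsf{StS}\setminus\mathsf{Scat}$. -/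

import Mathlib

namespace LinOrd

universe u

/-! ### Embeddings, epimorphisms, strong surjectivity -/

/-- There is an epimorphism (order preserving surjection) from `M` onto `L`. -/
def EpiLE (L M : Type*) [LinearOrder L] [LinearOrder M] : Prop :=
  ∃ f : M → L, Monotone f ∧ Function.Surjective f

/-- There is an embedding (order preserving injection) from `L` to `M`. -/
def EmbLE (L M : Type*) [LinearOrder L] [LinearOrder M] : Prop :=
  ∃ f : L → M, Monotone f ∧ Function.Injective f

/-- `M` surjects order-preservingly onto every (non-empty) linear order that embeds into it.
Any such order is isomorphic to a suborder of `M`, so it may be taken in the universe of `M`. -/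
def StronglySurjective (M : Type u) [LinearOrder M] : Prop :=
  ∀ (L : Type u) [LinearOrder L] [Nonempty L], EmbLE L M → EpiLE L M

/-- A linear order is scattered if the rationals do not embed into it. -/
def Scattered (L : Type*) [LinearOrder L] : Prop :=
  ¬ EmbLE ℚ L

/-! ### The space of countable linear orders -/

/-- `r ∈ 2^(ℕ × ℕ)` is a linear order on its domain `{n | r (n, n) = true}`, a non-empty set of
natural numbers; `r (m, n) = true` means `m ≤ n`. -/
structure IsLin (r : ℕ × ℕ → Bool) : Prop where
  nonempty : ∃ n, r (n, n) = true
  field : ∀ m n, r (m, n) = true → r (m, m) = true ∧ r (n, n) = true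
  antisymm : ∀ m n, r (m, n) = true → r (n, m) = true → m = n
  trans : ∀ k m n, r (k, m) = true → r (m, n) = true → r (k, n) = true
  total : ∀ m n, r (m, m) = true → r (n, n) = true → r (m, n) = true ∨ r (n, m) = true

/-- The space of all linear orders on non-empty subsets of `ℕ`; as a subtype it has the topology
induced by the product topology of `2^(ℕ × ℕ)`. -/
abbrev Lin : Type := {r : ℕ × ℕ → Bool // IsLin r}

namespace Lin

/-- The underlying set of an element of `Lin`. -/
def Carrier (L : Lin) : Type := {n : ℕ // L.1 (n, n) = true}

instance (L : Lin) : LinearOrder L.Carrier where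
  le a b := L.1 (a.1, b.1) = true
  le_refl a := a.2
  le_trans a b c := L.2.trans a.1 b.1 c.1
  le_antisymm a b h h' := Subtype.ext (L.2.antisymm a.1 b.1 h h')
  le_total a b := L.2.total a.1 b.1 a.2 b.2
  toDecidableLE a b := inferInstanceAs (Decidable (L.1 (a.1, b.1) = true))

open Classical in
/-- The copy in `Lin` of a non-empty linear order `α` along an injection `e : α → ℕ`:
its domain is the range of `e`, and `e a ≤ e b` holds iff `a ≤ b`. -/
noncomputable def copy {α : Type*} [LinearOrder α] [Nonempty α] (e : α → ℕ)
    (he : Function.Injective e) : Lin :=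
  ⟨fun p => decide (∃ a b, e a = p.1 ∧ e b = p.2 ∧ a ≤ b), by
    constructor
    · obtain ⟨a⟩ := ‹Nonempty α›
      exact ⟨e a, decide_eq_true ⟨a, a, rfl, rfl, le_rfl⟩⟩
    · intro m n h
      obtain ⟨a, b, rfl, rfl, -⟩ := of_decide_eq_true h
      exact ⟨decide_eq_true ⟨a, a, rfl, rfl, le_rfl⟩, decide_eq_true ⟨b, b, rfl, rfl, le_rfl⟩⟩
    · intro m n h h'
      obtain ⟨a, b, rfl, rfl, hab⟩ := of_decide_eq_true h
      obtain ⟨c, d, hc, hd, hcd⟩ := of_decide_eq_true h'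
      have hc' := he hc
      have hd' := he hd
      subst hc' hd'
      rw [le_antisymm hab hcd]
    · intro k m n h h'
      obtain ⟨a, b, rfl, rfl, hab⟩ := of_decide_eq_true h
      obtain ⟨c, d, hc, rfl, hcd⟩ := of_decide_eq_true h'
      have hc' := he hc
      subst hc'
      exact decide_eq_true ⟨a, d, rfl, rfl, hab.trans hcd⟩
    · intro m n h h'
      obtain ⟨a, _, rfl, -, -⟩ := of_decide_eq_true h
      obtain ⟨b, _, rfl, -, -⟩ := of_decide_eq_true h'
      rcases le_total a b with hab | hab
      · exact Or.inl (decide_eq_true ⟨a, b, rfl, rfl, hab⟩)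
      · exact Or.inr (decide_eq_true ⟨b, a, rfl, rfl, hab⟩)⟩

/-- A coding of `ℚ` by natural numbers (numerator and denominator). -/
def ratCode (q : ℚ) : ℕ := Nat.pair (Equiv.intEquivNat q.num) q.den

theorem ratCode_injective : Function.Injective ratCode := by
  intro p q h
  have h' := Nat.pair_eq_pair.1 h
  exact Rat.ext (Equiv.intEquivNat.injective h'.1) h'.2

/-- The coding of `η + Lω` by natural numbers. -/
def etaCode (L : Lin) (x : ℚ ⊕ₗ (ℕ ×ₗ L.Carrier)) : ℕ :=
  match ofLex x with
  | Sum.inl q => 2 * ratCode q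
  | Sum.inr p => 2 * Nat.pair (ofLex p).1 (ofLex p).2.1 + 1

theorem etaCode_injective (L : Lin) : Function.Injective (etaCode L) := by
  intro x y h
  apply ofLex.injective
  unfold etaCode at h
  rcases hx : ofLex x with p | p <;> rcases hy : ofLex y with q | q <;>
    simp only [hx, hy] at h
  · rw [ratCode_injective (by omega : ratCode p = ratCode q)]
  · omega
  · omega
  · have h' := Nat.pair_eq_pair.1 (by omega : Nat.pair (ofLex p).1 (ofLex p).2.1 =
      Nat.pair (ofLex q).1 (ofLex q).2.1)
    rw [ofLex.injective (Prod.ext h'.1 (Subtype.ext h'.2))]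

/-- The map `L ↦ η + Lω`: a copy of the rationals followed by `ω` consecutive copies of `L`. -/
noncomputable def etaAddMulOmega (L : Lin) : Lin :=
  copy (etaCode L) (etaCode_injective L)

end Lin

/-- The set of countable strongly surjective orders. -/
def StS : Set Lin := {L | StronglySurjective L.Carrier}

/-- The set of countable scattered orders. -/
def Scat : Set Lin := {L | Scattered L.Carrier}

/-! ### Descriptive set theory -/

/-- A finite list of conditions on a point `(x, y)` of `2^(ℕ × ℕ) × ℕ^ℕ`, each prescribing a value
of `x` or a value of `y`. -/
abbrev Condition : Type := List ((ℕ × ℕ) × Bool) × List (ℕ × ℕ)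

/-- The basic open subset of `2^(ℕ × ℕ) × ℕ^ℕ` determined by a finite list of conditions. -/
def basicOpen (c : Condition) : Set ((ℕ × ℕ → Bool) × (ℕ → ℕ)) :=
  {z | (∀ p ∈ c.1, z.1 p.1 = p.2) ∧ ∀ p ∈ c.2, z.2 p.1 = p.2}

/-- (Lightface) `Σ⁰₁` subsets of `2^(ℕ × ℕ) × ℕ^ℕ`: recursively enumerable unions of basic open
sets. -/
def LightfaceSigma01 (U : Set ((ℕ × ℕ → Bool) × (ℕ → ℕ))) : Prop :=
  ∃ E : Condition → Prop, REPred E ∧ U = {z | ∃ c, E c ∧ z ∈ basicOpen c}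

/-- (Lightface) `Σ¹₁` subsets of `2^(ℕ × ℕ)`: projections along `ℕ^ℕ` of (lightface) `Π⁰₁` sets. -/
def LightfaceSigma11 (A : Set (ℕ × ℕ → Bool)) : Prop :=
  ∃ F : Set ((ℕ × ℕ → Bool) × (ℕ → ℕ)), LightfaceSigma01 Fᶜ ∧ A = {x | ∃ y, (x, y) ∈ F}

/-- `f` is a continuous reduction of `A` to `B`. -/
def Reduces {X Y : Type*} [TopologicalSpace X] [TopologicalSpace Y] (f : X → Y) (A : Set X)
    (B : Set Y) : Prop :=
  Continuous f ∧ ∀ x, x ∈ A ↔ f x ∈ B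

/-- Boldface `Σ¹₁`-hardness: every analytic subset of a zero-dimensional Polish space continuously
reduces to `B`. -/
def Sigma11Hard {Y : Type*} [TopologicalSpace Y] (B : Set Y) : Prop :=
  ∀ (X : Type) [TopologicalSpace X] [PolishSpace X],
    TopologicalSpace.IsTopologicalBasis {s : Set X | IsClopen s} →
    ∀ A : Set X, MeasureTheory.AnalyticSet A → ∃ f : X → Y, Reduces f A B

/-- Boldface `Σ¹₁`-completeness: analytic and `Σ¹₁`-hard. -/
def Sigma11Complete {Y : Type*} [TopologicalSpace Y] (B : Set Y) : Prop :=
  MeasureTheory.AnalyticSet B ∧ Sigma11Hard B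

end LinOrd

/-! By Cantor's theorem `L ×ₗ ℚ` is a copy of `ℚ` for every countable `L`, so `ℚ` surjects onto
every countable order. Hence a countable order is strongly surjective and non-scattered iff it
surjects onto `ℚ` (`stronglySurjective_and_not_scattered_iff`), and everything reduces to the study
of `EpiLE ℚ M`.

Reduction: if `ℚ` embeds into `L`, then `L` maps monotonically into `[0, 1]` attaining all rationals
there; placing the copies of `L` at `[n, n + 1]` and `η` on the negative rationals covers `ℚ`.
Conversely, a section of an epimorphism puts a bounded interval of `ℚ` into finitely many copies of
`L`, so a subinterval lies in one of them. As `η + Lω` is never scattered, the map serves for both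
target sets.

Hardness: an analytic set consists of the points whose tree, chosen continuously, has an infinite
branch (`exists_clopen_scheme`). Doubling every child to the left and right of its parent and
traversing in order gives a linear order that contains `ℚ` iff the tree has a branch
(`embLE_rat_labels_iff`).

Upper bound: an epimorphism onto `ℚ` together with a section is coded by a point of Baire space, and
being such a code is a `Π⁰₁` condition (`badCode`). Boldface analyticity follows. -/

namespace LinOrd

/-! ### Epimorphisms onto the rationals -/

theorem EpiLE.trans {K L M : Type*} [LinearOrder K] [LinearOrder L] [LinearOrder M]
    (h : EpiLE K L) (h' : EpiLE L M) : EpiLE K M := by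
  obtain ⟨f, hf, hf'⟩ := h
  obtain ⟨g, hg, hg'⟩ := h'
  exact ⟨f ∘ g, hf.comp hg, hf'.comp hg'⟩

theorem EmbLE.trans {K L M : Type*} [LinearOrder K] [LinearOrder L] [LinearOrder M]
    (h : EmbLE K L) (h' : EmbLE L M) : EmbLE K M := by
  obtain ⟨f, hf, hf'⟩ := h
  obtain ⟨g, hg, hg'⟩ := h'
  exact ⟨g ∘ f, hg.comp hf, hg'.comp hf'⟩

theorem _root_.OrderIso.embLE {L M : Type*} [LinearOrder L] [LinearOrder M] (e : L ≃o M) :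
    EmbLE L M :=
  ⟨e, e.monotone, e.injective⟩

theorem _root_.OrderIso.epiLE {L M : Type*} [LinearOrder L] [LinearOrder M] (e : M ≃o L) :
    EpiLE L M :=
  ⟨e, e.monotone, e.surjective⟩

theorem embLE_of_strictMono {L M : Type*} [LinearOrder L] [LinearOrder M] {f : L → M}
    (hf : StrictMono f) : EmbLE L M :=
  ⟨f, hf.monotone, hf.injective⟩

theorem EmbLE.exists_strictMono {L M : Type*} [LinearOrder L] [LinearOrder M] (h : EmbLE L M) :
    ∃ f : L → M, StrictMono f := by
  obtain ⟨f, hf, hf'⟩ := h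
  exact ⟨f, hf.strictMono_of_injective hf'⟩

/-- An epimorphism has an order embedding as a section. -/
theorem EpiLE.exists_section {L M : Type*} [LinearOrder L] [LinearOrder M] {f : M → L}
    (hf : Monotone f) (hf' : Function.Surjective f) :
    ∃ s : L → M, StrictMono s ∧ ∀ x, f (s x) = x := by
  choose s hs using hf'
  refine ⟨s, fun x y hxy => ?_, hs⟩
  by_contra h
  have := hf (not_lt.1 h)
  rw [hs, hs] at this
  exact absurd hxy (not_lt.2 this)

theorem EpiLE.embLE {L M : Type*} [LinearOrder L] [LinearOrder M] (h : EpiLE L M) : EmbLE L M := by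
  obtain ⟨f, hf, hf'⟩ := h
  obtain ⟨s, hs, -⟩ := EpiLE.exists_section hf hf'
  exact embLE_of_strictMono hs

/-- The rationals surject onto every non-empty countable linear order. -/
theorem epiLE_rat (L : Type*) [LinearOrder L] [Nonempty L] [Countable L] : EpiLE L ℚ := by
  -- Replacing each point of `L` by a copy of `ℚ` gives a countable dense order without endpoints;
  -- the first projection collapses it onto `L`.
  have : Countable (L ×ₗ ℚ) := inferInstanceAs (Countable (L × ℚ))
  have : Nonempty (L ×ₗ ℚ) := inferInstanceAs (Nonempty (L × ℚ))
  obtain ⟨e⟩ := Order.iso_of_countable_dense ℚ (L ×ₗ ℚ)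
  refine EpiLE.trans ⟨fun p : L ×ₗ ℚ => (ofLex p).1, fun p q h => ?_, fun x => ⟨toLex (x, 0), rfl⟩⟩
    e.epiLE
  rcases Prod.Lex.le_iff.1 h with h | h
  · exact h.le
  · exact h.1.le

/-- A countable non-scattered order is strongly surjective iff it surjects onto the rationals. -/
theorem stronglySurjective_and_not_scattered_iff {M : Type} [LinearOrder M] [Countable M] :
    StronglySurjective M ∧ ¬ Scattered M ↔ EpiLE ℚ M := by
  constructor
  · rintro ⟨h, h'⟩
    exact h ℚ (not_not.1 h')
  · intro h
    refine ⟨fun L _ _ hL => ?_, not_not.2 h.embLE⟩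
    obtain ⟨f, -, hf⟩ := hL
    have : Countable L := hf.countable
    exact (epiLE_rat L).trans h

/-- A countable order with a monotone map to the reals that attains all rational values surjects
onto the rationals. -/
theorem epiLE_rat_of_monotone_real {M : Type*} [LinearOrder M] [Countable M] {f : M → ℝ}
    (hf : Monotone f) (h : ∀ q : ℚ, (q : ℝ) ∈ Set.range f) : EpiLE ℚ M := by
  -- The range may contain irrationals, but it is countable and contains `ℚ`, hence dense without
  -- endpoints, so Cantor's theorem applies to it.
  have : Countable (Set.range f) := (Set.countable_range f).to_subtype
  have : Nonempty (Set.range f) := ⟨⟨_, h 0⟩⟩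
  have : DenselyOrdered (Set.range f) := ⟨fun a b hab => by
    obtain ⟨q, hq, hq'⟩ := exists_rat_btwn (show (a : ℝ) < b from hab)
    exact ⟨⟨q, h q⟩, hq, hq'⟩⟩
  have : NoMinOrder (Set.range f) := ⟨fun a => by
    obtain ⟨q, hq⟩ := exists_rat_lt (a : ℝ)
    exact ⟨⟨q, h q⟩, hq⟩⟩
  have : NoMaxOrder (Set.range f) := ⟨fun a => by
    obtain ⟨q, hq⟩ := exists_rat_gt (a : ℝ)
    exact ⟨⟨q, h q⟩, hq⟩⟩
  obtain ⟨e⟩ := Order.iso_of_countable_dense (Set.range f) ℚ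
  exact e.epiLE.trans ⟨Set.rangeFactorization f, fun a b hab => hf hab,
    Set.rangeFactorization_surjective⟩

/-- A strictly monotone map on a non-trivial rational interval gives an embedding of `ℚ`. -/
theorem embLE_rat_of_strictMonoOn {M : Type*} [LinearOrder M] {a b : ℚ} (hab : a < b) {f : ℚ → M}
    (hf : StrictMonoOn f (Set.Icc a b)) : EmbLE ℚ M := by
  have : Nonempty (Set.Ioo a b) := (Set.nonempty_Ioo.2 hab).to_subtype
  obtain ⟨e⟩ := Order.iso_of_countable_dense ℚ (Set.Ioo a b)
  exact embLE_of_strictMono (f := fun q => f (e q)) fun p q hpq =>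
    hf (Set.Ioo_subset_Icc_self (e p).2) (Set.Ioo_subset_Icc_self (e q).2) (e.strictMono hpq)

/-- An integer-valued map that is monotone on a non-trivial rational interval is constant on a
non-trivial subinterval. -/
theorem exists_Icc_eq_of_monotoneOn_int {h : ℚ → ℤ} :
    ∀ {a b : ℚ}, a < b → MonotoneOn h (Set.Icc a b) →
      ∃ a' b', a ≤ a' ∧ a' < b' ∧ b' ≤ b ∧ ∀ q ∈ Set.Icc a' b', h q = h a' := by
  suffices H : ∀ (n : ℕ) {a b : ℚ}, a < b → MonotoneOn h (Set.Icc a b) → (h b - h a).toNat = n →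
      ∃ a' b', a ≤ a' ∧ a' < b' ∧ b' ≤ b ∧ ∀ q ∈ Set.Icc a' b', h q = h a' from
    fun {a b} hab hh => H _ hab hh rfl
  intro n
  induction n using Nat.strong_induction_on with
  | _ n ih =>
    intro a b hab hh hn
    obtain ⟨c, hac, hcb⟩ := exists_between hab
    have ha : a ∈ Set.Icc a b := ⟨le_rfl, hab.le⟩
    have hb : b ∈ Set.Icc a b := ⟨hab.le, le_rfl⟩
    have hc : c ∈ Set.Icc a b := ⟨hac.le, hcb.le⟩
    have h1 := hh ha hc hac.le
    have h2 := hh hc hb hcb.le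
    -- Induction on the total rise: either `h` does not rise on `[a, c]`, or its rise on `[c, b]` is
    -- strictly smaller.
    rcases h1.eq_or_lt with h3 | h3
    · refine ⟨a, c, le_rfl, hac, hcb.le, fun q hq => le_antisymm ?_ ?_⟩
      · exact (hh ⟨hq.1, hq.2.trans hcb.le⟩ hc hq.2).trans h3.ge
      · exact hh ha ⟨hq.1, hq.2.trans hcb.le⟩ hq.1
    · obtain ⟨a', b', h4, h5, h6, h7⟩ := ih (h b - h c).toNat (by omega) hcb
        (hh.mono (Set.Icc_subset_Icc_left hac.le)) rfl
      exact ⟨a', b', hac.le.trans h4, h5, h6, h7⟩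

/-! ### The order `η + Lω` -/

/-- A monotone real function on an order containing `ℚ`, sending the copy of `q ∈ [0, 1]` to `q`. -/
theorem exists_monotone_unitInterval {L : Type*} [LinearOrder L] {e : ℚ → L} (he : StrictMono e) :
    ∃ g : L → ℝ, Monotone g ∧ (∀ x, 0 ≤ g x ∧ g x ≤ 1) ∧
      ∀ q : ℚ, 0 ≤ q → q ≤ 1 → g (e q) = q := by
  -- The value at `x` is the supremum of the cut that `x` makes in the copy of `[0, 1]`; inserting
  -- `0` handles the points below that copy.
  let S : L → Set ℝ := fun x => insert 0 {r | ∃ p : ℚ, 0 ≤ p ∧ p ≤ 1 ∧ e p ≤ x ∧ (p : ℝ) = r}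
  have hS : ∀ x, ∀ r ∈ S x, r ≤ 1 := by
    rintro x r (rfl | ⟨p, -, hp, -, rfl⟩)
    · exact zero_le_one
    · exact_mod_cast hp
  have hbdd : ∀ x, BddAbove (S x) := fun x => ⟨1, hS x⟩
  have hne : ∀ x, (S x).Nonempty := fun x => ⟨0, Set.mem_insert _ _⟩
  refine ⟨fun x => sSup (S x), fun x y hxy => csSup_le_csSup (hbdd y) (hne x) ?_,
    fun x => ⟨le_csSup (hbdd x) (Set.mem_insert _ _), csSup_le (hne x) (hS x)⟩,
    fun q h0 h1 => le_antisymm (csSup_le (hne _) ?_) ?_⟩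
  · refine Set.insert_subset_insert ?_
    rintro r ⟨p, h0, h1, h2, h3⟩
    exact ⟨p, h0, h1, h2.trans hxy, h3⟩
  · rintro r (rfl | ⟨p, -, -, hp, rfl⟩)
    · exact_mod_cast h0
    · exact_mod_cast he.le_iff_le.1 hp
  · exact le_csSup (hbdd _) (Or.inr ⟨q, h0, h1, le_rfl, rfl⟩)

/-- The copy of `ℚ` goes onto the negative rationals and the `n`-th copy of `L` into `[n, n + 1]` by
`n + g`. A rational `q ≥ 0` is attained in copy `⌊q⌋₊` at its fractional part. -/
theorem epiLE_rat_etaAddMulOmega_of_not_scattered {L : Type*} [LinearOrder L] [Countable L]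
    (h : ¬ Scattered L) : EpiLE ℚ (ℚ ⊕ₗ (ℕ ×ₗ L)) := by
  obtain ⟨e, he⟩ := (not_not.1 h).exists_strictMono
  obtain ⟨g, hg, hg', hge⟩ := exists_monotone_unitInterval he
  obtain ⟨i⟩ := Order.iso_of_countable_dense ℚ (Set.Iio (0 : ℚ))
  have : Countable (ℚ ⊕ₗ (ℕ ×ₗ L)) := inferInstanceAs (Countable (ℚ ⊕ (ℕ × L)))
  let f : ℚ ⊕ₗ (ℕ ×ₗ L) → ℝ := fun x =>
    Sum.elim (fun q => (((i q : ℚ) : ℝ))) (fun p => ((ofLex p).1 : ℝ) + g (ofLex p).2) (ofLex x)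
  refine epiLE_rat_of_monotone_real (f := f) (fun x y hxy => ?_) fun q => ?_
  · rcases hxy with ⟨hab⟩ | ⟨hab⟩ | ⟨_, _⟩
    · rename_i a b
      show ((i a : ℚ) : ℝ) ≤ ((i b : ℚ) : ℝ)
      exact_mod_cast i.monotone hab
    · rename_i a b
      show ((ofLex a).1 : ℝ) + g (ofLex a).2 ≤ ((ofLex b).1 : ℝ) + g (ofLex b).2
      rcases Prod.Lex.le_iff.1 hab with h | h
      · have h' : ((ofLex a).1 : ℝ) + 1 ≤ (ofLex b).1 := by exact_mod_cast h
        linarith [(hg' (ofLex a).2).2, (hg' (ofLex b).2).1]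
      · rw [h.1]
        exact add_le_add_right (hg h.2) _
    · rename_i a b
      show ((i a : ℚ) : ℝ) ≤ ((ofLex b).1 : ℝ) + g (ofLex b).2
      have h1 : ((i a : ℚ) : ℝ) < 0 := by exact_mod_cast (i a).2
      linarith [(hg' (ofLex b).2).1, (Nat.cast_nonneg (ofLex b).1 : (0 : ℝ) ≤ _)]
  · rcases lt_or_ge q 0 with hq | hq
    · exact ⟨toLex (Sum.inl (i.symm ⟨q, hq⟩)), by simp [f]⟩
    · refine ⟨toLex (Sum.inr (toLex (⌊q⌋₊, e (q - ⌊q⌋₊)))), ?_⟩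
      have h1 := Nat.floor_le hq
      have h2 := Nat.lt_floor_add_one q
      simp only [f, ofLex_toLex, Sum.elim_inr]
      rw [hge _ (by linarith) (by linarith)]
      push_cast
      ring

/-- Let `z` lie in the first copy of `L`. The section sends every rational above `f z` beyond the
summand `ℚ`. On a bounded interval of such rationals the index of the copy is monotone, so it is
constant on a subinterval, which therefore embeds into `L`. -/
theorem not_scattered_of_epiLE_rat_etaAddMulOmega {L : Type*} [LinearOrder L] [Nonempty L]
    (h : EpiLE ℚ (ℚ ⊕ₗ (ℕ ×ₗ L))) : ¬ Scattered L := by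
  obtain ⟨f, hf, hf'⟩ := h
  obtain ⟨s, hs, hfs⟩ := EpiLE.exists_section hf hf'
  obtain ⟨l₀⟩ := ‹Nonempty L›
  set z : ℚ ⊕ₗ (ℕ ×ₗ L) := toLex (Sum.inr (toLex (0, l₀))) with hz
  have hinr : ∀ q, f z < q → ∃ p : ℕ ×ₗ L, s q = toLex (Sum.inr p) := by
    intro q hq
    rcases hx : ofLex (s q) with a | p
    · have h1 : s q ≤ z := by
        rw [← toLex_ofLex (s q), hx, hz]
        exact Sum.Lex.inl_le_inr a _
      have h2 := hf h1
      rw [hfs] at h2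
      exact absurd hq (not_lt.2 h2)
    · exact ⟨p, by rw [← hx, toLex_ofLex]⟩
  choose! p hp using hinr
  have hpm : ∀ {q r}, f z < q → q < r → p q < p r := by
    intro q r hq hqr
    have h1 := hs hqr
    rw [hp q hq, hp r (hq.trans hqr)] at h1
    exact Sum.Lex.inr_lt_inr_iff.1 h1
  obtain ⟨a, b, ha, hab, -, h⟩ := exists_Icc_eq_of_monotoneOn_int
    (h := fun q => ((ofLex (p q)).1 : ℤ)) (a := f z + 1) (b := f z + 2) (by linarith) (by
      intro q hq r hr hqr
      rcases hqr.eq_or_lt with rfl | hqr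
      · exact le_rfl
      have := hpm (by linarith [hq.1]) hqr
      show ((ofLex (p q)).1 : ℤ) ≤ ((ofLex (p r)).1 : ℤ)
      rcases Prod.Lex.lt_iff.1 this with h | h
      · exact_mod_cast h.le
      · exact_mod_cast h.1.le)
  refine not_not.2 (embLE_rat_of_strictMonoOn hab (f := fun q => (ofLex (p q)).2) ?_)
  intro q hq r hr hqr
  rcases Prod.Lex.lt_iff.1 (hpm (by linarith [hq.1]) hqr) with h' | h'
  · have h1 : ((ofLex (p q)).1 : ℤ) = (ofLex (p r)).1 := (h q hq).trans (h r hr).symm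
    exact absurd h' (by omega)
  · exact h'.2

/-! ### Copies -/

instance (L : Lin) : Countable L.Carrier := inferInstanceAs (Countable {_n : ℕ // _})

instance (L : Lin) : Nonempty L.Carrier := L.2.nonempty.elim fun _ hn => ⟨⟨_, hn⟩⟩

theorem Lin.copy_apply_eq_true {α : Type*} [LinearOrder α] [Nonempty α] (e : α → ℕ)
    (he : Function.Injective e) (p : ℕ × ℕ) :
    (Lin.copy e he).1 p = true ↔ ∃ a b, e a = p.1 ∧ e b = p.2 ∧ a ≤ b := by
  simp [Lin.copy]

theorem Lin.nonempty_orderIso_copy {α : Type*} [LinearOrder α] [Nonempty α] (e : α → ℕ)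
    (he : Function.Injective e) : Nonempty (α ≃o (Lin.copy e he).Carrier) := by
  let f : α → (Lin.copy e he).Carrier := fun a =>
    ⟨e a, (Lin.copy_apply_eq_true e he _).2 ⟨a, a, rfl, rfl, le_rfl⟩⟩
  have hf : StrictMono f := by
    refine Monotone.strictMono_of_injective (fun a b hab => ?_) fun a b hab =>
      he (congrArg Subtype.val hab)
    exact (Lin.copy_apply_eq_true e he _).2 ⟨a, b, rfl, rfl, hab⟩
  refine ⟨StrictMono.orderIsoOfSurjective f hf fun x => ?_⟩
  obtain ⟨a, b, ha, -, -⟩ := (Lin.copy_apply_eq_true e he _).1 x.2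
  exact ⟨a, Subtype.ext ha⟩

theorem mem_StS_diff_Scat_iff (L : Lin) : L ∈ StS \ Scat ↔ EpiLE ℚ L.Carrier :=
  stronglySurjective_and_not_scattered_iff

theorem mem_compl_Scat_iff_etaAddMulOmega (L : Lin) :
    L ∈ Scatᶜ ↔ L.etaAddMulOmega ∈ StS \ Scat := by
  have : Nonempty (ℚ ⊕ₗ (ℕ ×ₗ L.Carrier)) := ⟨toLex (Sum.inl 0)⟩
  obtain ⟨i⟩ := Lin.nonempty_orderIso_copy _ (Lin.etaCode_injective L)
  rw [mem_StS_diff_Scat_iff]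
  constructor
  · intro h
    exact (epiLE_rat_etaAddMulOmega_of_not_scattered h).trans i.symm.epiLE
  · intro h
    exact not_scattered_of_epiLE_rat_etaAddMulOmega (h.trans i.epiLE)

/-- The summand `η` is a copy of `ℚ` whatever `L` is, so `StS` and `StS \ Scat` have the same
preimage under the map. -/
theorem etaAddMulOmega_notMem_Scat (L : Lin) : L.etaAddMulOmega ∉ Scat := by
  have : Nonempty (ℚ ⊕ₗ (ℕ ×ₗ L.Carrier)) := ⟨toLex (Sum.inl 0)⟩
  obtain ⟨i⟩ := Lin.nonempty_orderIso_copy _ (Lin.etaCode_injective L)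
  refine not_not.2 (EmbLE.trans (embLE_of_strictMono (f := fun q : ℚ => toLex (Sum.inl q)) ?_)
    i.embLE)
  exact fun p q h => Sum.Lex.inl_lt_inl_iff.2 h

theorem mem_compl_Scat_iff_etaAddMulOmega_mem_StS (L : Lin) :
    L ∈ Scatᶜ ↔ L.etaAddMulOmega ∈ StS := by
  rw [mem_compl_Scat_iff_etaAddMulOmega]
  exact ⟨fun h => h.1, fun h => ⟨h, etaAddMulOmega_notMem_Scat L⟩⟩

/-! ### Continuity of maps to `Lin` -/

/-- A map to `Lin` is continuous if each relation `m ≤ n` holds on a clopen set. -/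
theorem Lin.continuous_of_forall_isClopen {X : Type*} [TopologicalSpace X] {F : X → Lin}
    (h : ∀ p, IsClopen {x | (F x).1 p = true}) : Continuous F := by
  refine Continuous.subtype_mk (continuous_pi fun p => ?_) _
  exact (continuous_bool_rng true).2 (h p)

theorem Lin.continuous_apply (p : ℕ × ℕ) : Continuous fun L : Lin => L.1 p :=
  (_root_.continuous_apply p).comp continuous_subtype_val

theorem Lin.unpair_etaCode_inr_snd (L : Lin) (p : ℕ ×ₗ L.Carrier) :
    (Nat.unpair (Lin.etaCode L (toLex (Sum.inr p)) / 2)).2 = (ofLex p).2.1 := by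
  have : Lin.etaCode L (toLex (Sum.inr p)) / 2 = Nat.pair (ofLex p).1 (ofLex p).2.1 := by
    show (2 * Nat.pair (ofLex p).1 (ofLex p).2.1 + 1) / 2 = _
    omega
  rw [this, Nat.unpair_pair]

/-- Halving removes the parity tag and unpairing drops the index of the copy, so one bit of the
image depends on at most three bits of `L`. This gives continuity. -/
theorem Lin.etaAddMulOmega_apply_congr {L L' : Lin} {m n : ℕ}
    (h1 : L.1 ((Nat.unpair (m / 2)).2, (Nat.unpair (m / 2)).2) =
      L'.1 ((Nat.unpair (m / 2)).2, (Nat.unpair (m / 2)).2))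
    (h2 : L.1 ((Nat.unpair (n / 2)).2, (Nat.unpair (n / 2)).2) =
      L'.1 ((Nat.unpair (n / 2)).2, (Nat.unpair (n / 2)).2))
    (h3 : L.1 ((Nat.unpair (m / 2)).2, (Nat.unpair (n / 2)).2) =
      L'.1 ((Nat.unpair (m / 2)).2, (Nat.unpair (n / 2)).2))
    (h : L.etaAddMulOmega.1 (m, n) = true) : L'.etaAddMulOmega.1 (m, n) = true := by
  rw [Lin.etaAddMulOmega, Lin.copy_apply_eq_true] at h ⊢
  obtain ⟨a, b, rfl, rfl, hab⟩ := h
  obtain ⟨a, rfl⟩ := toLex.surjective a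
  obtain ⟨b, rfl⟩ := toLex.surjective b
  rcases a with a | a <;> rcases b with b | b
  · exact ⟨toLex (Sum.inl a), toLex (Sum.inl b), rfl, rfl,
      Sum.Lex.inl_le_inl_iff.2 (Sum.Lex.inl_le_inl_iff.1 hab)⟩
  · simp only [Lin.unpair_etaCode_inr_snd] at h2
    exact ⟨toLex (Sum.inl a), toLex (Sum.inr (toLex ((ofLex b).1, ⟨(ofLex b).2.1,
      h2.symm.trans (ofLex b).2.2⟩))), rfl, rfl, Sum.Lex.inl_le_inr _ _⟩
  · exact absurd hab Sum.Lex.not_inr_le_inl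
  · simp only [Lin.unpair_etaCode_inr_snd] at h1 h2 h3
    refine ⟨toLex (Sum.inr (toLex ((ofLex a).1, ⟨(ofLex a).2.1, h1.symm.trans (ofLex a).2.2⟩))),
      toLex (Sum.inr (toLex ((ofLex b).1, ⟨(ofLex b).2.1, h2.symm.trans (ofLex b).2.2⟩))),
      rfl, rfl, Sum.Lex.inr_le_inr_iff.2 (Prod.Lex.le_iff.2 ?_)⟩
    rcases Prod.Lex.le_iff.1 (Sum.Lex.inr_le_inr_iff.1 hab) with h | h
    · exact Or.inl h
    · exact Or.inr ⟨h.1, h3.symm.trans h.2⟩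

theorem Lin.continuous_etaAddMulOmega : Continuous Lin.etaAddMulOmega := by
  refine Continuous.subtype_mk (continuous_pi fun p => ?_) _
  obtain ⟨m, n⟩ := p
  let i := (Nat.unpair (m / 2)).2
  let j := (Nat.unpair (n / 2)).2
  refine (IsLocallyConstant.iff_eventually_eq _).2 (fun L => ?_) |>.continuous
  have key : ∀ p : ℕ × ℕ, ∀ᶠ L' in nhds L, L'.1 p = L.1 p := fun p =>
    ((IsLocallyConstant.iff_continuous _).2 (Lin.continuous_apply p)).eventually_eq L
  filter_upwards [key (i, i), key (j, j), key (i, j)] with L' h1 h2 h3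
  exact Bool.eq_iff_iff.2 ⟨Lin.etaAddMulOmega_apply_congr h1 h2 h3,
    Lin.etaAddMulOmega_apply_congr h1.symm h2.symm h3.symm⟩

/-! ### In-order traversal of doubled trees -/

/-- Finite sequences of non-zero integers. -/
def SignedList : Type := {l : List ℤ // (0 : ℤ) ∉ l}

namespace SignedList

instance : Countable SignedList := inferInstanceAs (Countable {_l : List ℤ // _})

/-- A finite sequence continued by zeros. -/
def key (l : SignedList) : Lex (ℕ → ℤ) := toLex fun n => l.1.getD n 0

theorem key_apply (l : SignedList) (n : ℕ) : l.key n = l.1.getD n 0 := rfl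

/-- Entries are non-zero, so the first padding zero marks the length. Zero also separates negative
from positive entries, which puts a node between its left and right children. -/
theorem key_eq_zero_iff (l : SignedList) (n : ℕ) : l.key n = 0 ↔ l.1.length ≤ n := by
  rw [key_apply]
  constructor
  · intro h
    by_contra h'
    rw [List.getD_eq_getElem _ _ (not_le.1 h')] at h
    have hm := List.getElem_mem (not_le.1 h')
    rw [h] at hm
    exact l.2 hm
  · exact fun h => List.getD_eq_default _ _ h

theorem key_injective : Function.Injective key := by
  intro l l' h
  have h' : ∀ n, l.key n = l'.key n := fun n => congrFun h n
  have hlen : ∀ n, l.1.length ≤ n ↔ l'.1.length ≤ n := fun n => by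
    rw [← key_eq_zero_iff, h', key_eq_zero_iff]
  refine Subtype.ext (List.ext_getElem
    (le_antisymm ((hlen _).2 le_rfl) ((hlen _).1 le_rfl)) fun n h1 h2 => ?_)
  have := h' n
  rwa [key_apply, key_apply, List.getD_eq_getElem _ _ h1, List.getD_eq_getElem _ _ h2] at this

/-- The in-order traversal: the lexicographic order of sequences continued by zeros. -/
noncomputable instance : LinearOrder SignedList := LinearOrder.lift' key key_injective

theorem lt_iff {l l' : SignedList} :
    l < l' ↔ ∃ i, (∀ j < i, l.key j = l'.key j) ∧ l.key i < l'.key i := Iff.rfl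

theorem key_le_key_of_le {l l' : SignedList} (h : l ≤ l') {n : ℕ}
    (hn : ∀ j < n, l.key j = l'.key j) : l.key n ≤ l'.key n := by
  by_contra hlt
  exact absurd h (not_le.2 (lt_iff.2 ⟨n, fun j hj => (hn j hj).symm, not_le.1 hlt⟩))

/-- The child of a sequence in direction `a`. -/
def child (l : SignedList) (a : ℤ) (ha : a ≠ 0) : SignedList :=
  ⟨l.1 ++ [a], by simpa [ha.symm] using l.2⟩

theorem key_child_of_lt {l : SignedList} {a : ℤ} {ha : a ≠ 0} {n : ℕ} (hn : n < l.1.length) :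
    (l.child a ha).key n = l.key n :=
  List.getD_append _ _ _ _ hn

theorem key_child_length {l : SignedList} {a : ℤ} {ha : a ≠ 0} :
    (l.child a ha).key l.1.length = a := by
  rw [key_apply, child, List.getD_append_right _ _ _ _ le_rfl]
  simp

theorem lt_child {l : SignedList} {a : ℤ} (ha : a ≠ 0) (h : 0 < a) : l < l.child a ha :=
  lt_iff.2 ⟨l.1.length, fun _ hj => (key_child_of_lt hj).symm, by
    rw [key_child_length, (key_eq_zero_iff l _).2 le_rfl]
    exact h⟩

theorem child_lt {l : SignedList} {a : ℤ} (ha : a ≠ 0) (h : a < 0) : l.child a ha < l :=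
  lt_iff.2 ⟨l.1.length, fun _ hj => key_child_of_lt hj, by
    rw [key_child_length, (key_eq_zero_iff l _).2 le_rfl]
    exact h⟩

/-- Between two elements there is a right child of the smaller or a left child of the larger. -/
theorem child_lt_or_lt_child {l l' : SignedList} (h : l < l') {a b : ℤ} (ha : a ≠ 0) (hb : b ≠ 0) :
    l.child a ha < l' ∨ l < l'.child b hb := by
  obtain ⟨i, hi, hlt⟩ := lt_iff.1 h
  -- Extending a sequence that is longer than the first difference `i` does not affect the
  -- comparison. If `l'` has ended by `i`, its key there is `0`, so that of `l` is negative and `l`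
  -- has not ended.
  by_cases h' : i < l'.1.length
  · exact Or.inr (lt_iff.2 ⟨i, fun j hj => (hi j hj).trans (key_child_of_lt (hj.trans h')).symm,
      hlt.trans_eq (key_child_of_lt h').symm⟩)
  · have h0 := (key_eq_zero_iff l' i).2 (not_lt.1 h')
    have h1 : i < l.1.length := by
      by_contra h1
      rw [h0, (key_eq_zero_iff l i).2 (not_lt.1 h1)] at hlt
      exact lt_irrefl _ hlt
    exact Or.inl (lt_iff.2 ⟨i, fun j hj => (key_child_of_lt (hj.trans h1)).trans (hi j hj),
      (key_child_of_lt h1).trans_lt hlt⟩)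

/-- A non-empty set of sequences in which every element has both a positive and a negative child
contains a copy of `ℚ`. -/
theorem embLE_rat_of_children {S : Set SignedList} (hne : S.Nonempty)
    (hpos : ∀ l ∈ S, ∃ (a : ℤ) (ha : a ≠ 0), 0 < a ∧ l.child a ha ∈ S)
    (hneg : ∀ l ∈ S, ∃ (a : ℤ) (ha : a ≠ 0), a < 0 ∧ l.child a ha ∈ S) : EmbLE ℚ S := by
  have : Nonempty S := hne.to_subtype
  have : NoMaxOrder S := ⟨fun l => by
    obtain ⟨a, ha, h, h'⟩ := hpos l l.2
    exact ⟨⟨_, h'⟩, lt_child ha h⟩⟩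
  have : NoMinOrder S := ⟨fun l => by
    obtain ⟨a, ha, h, h'⟩ := hneg l l.2
    exact ⟨⟨_, h'⟩, child_lt ha h⟩⟩
  have : DenselyOrdered S := ⟨fun l l' hl => by
    obtain ⟨a, ha, h1, h1'⟩ := hpos l l.2
    obtain ⟨b, hb, h2, h2'⟩ := hneg l' l'.2
    rcases child_lt_or_lt_child hl ha hb with h | h
    · exact ⟨⟨_, h1'⟩, lt_child ha h1, h⟩
    · exact ⟨⟨_, h2'⟩, h, child_lt hb h2⟩⟩
  obtain ⟨e⟩ := Order.iso_of_countable_dense ℚ S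
  exact e.embLE

/-- A copy of `ℚ` in the sequences yields an infinite branch all of whose finite initial segments
are initial segments of members of the copy. -/
theorem exists_branch_of_strictMono {e : ℚ → SignedList} (he : StrictMono e) :
    ∃ k : ℕ → ℤ, ∀ n, ∃ q, (List.range n).map k <+: (e q).1 := by
  let good : List ℤ → Prop := fun u => ∃ a b, a < b ∧ ∀ q ∈ Set.Icc a b, u <+: (e q).1
  -- Images extending `u` have a next entry that is monotone in `q`, hence constant on a
  -- subinterval. The constant is not the padding `0`, since both endpoints would then be sent to
  -- `u`.
  have step : ∀ u : {u // good u}, ∃ k : ℤ, good (u.1 ++ [k]) := by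
    rintro ⟨u, a, b, hab, hu⟩
    have hkey : ∀ q ∈ Set.Icc a b, ∀ j < u.length, (e q).key j = u.getD j 0 := by
      intro q hq j hj
      obtain ⟨v, hv⟩ := hu q hq
      rw [key_apply, ← hv, List.getD_append _ _ _ _ hj]
    obtain ⟨a', b', h1, h2, h3, h4⟩ := exists_Icc_eq_of_monotoneOn_int
      (h := fun q => (e q).key u.length) hab (fun q hq r hr hqr =>
        key_le_key_of_le (he.monotone hqr) fun j hj =>
          (hkey q hq j hj).trans (hkey r hr j hj).symm)
    have hsub : Set.Icc a' b' ⊆ Set.Icc a b := Set.Icc_subset_Icc h1 h3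
    have ha' : a' ∈ Set.Icc a' b' := ⟨le_rfl, h2.le⟩
    have hb' : b' ∈ Set.Icc a' b' := ⟨h2.le, le_rfl⟩
    have hlen : ∀ q ∈ Set.Icc a' b', (e q).key u.length = 0 → (e q).1 = u := by
      intro q hq h0
      exact ((hu q (hsub hq)).eq_of_length_le ((key_eq_zero_iff _ _).1 h0)).symm
    have hk : (e a').key u.length ≠ 0 := by
      intro h0
      have := he.injective (Subtype.ext
        ((hlen a' ha' h0).trans (hlen b' hb' ((h4 b' hb').trans h0)).symm))
      exact h2.ne this
    refine ⟨(e a').key u.length, a', b', h2, fun q hq => ?_⟩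
    obtain ⟨v, hv⟩ := hu q (hsub hq)
    have hqk : (e q).key u.length = (e a').key u.length := h4 q hq
    rw [← hqk] at hk ⊢
    have hl : (e q).key u.length = v.getD 0 0 := by
      rw [key_apply, ← hv, List.getD_append_right _ _ _ _ le_rfl, Nat.sub_self]
    rw [hl] at hk ⊢
    cases v with
    | nil => simp at hk
    | cons c v => exact ⟨v, by simp [← hv]⟩
  choose k hk using step
  let U : ℕ → {u // good u} := fun n => Nat.rec
    ⟨[], 0, 1, zero_lt_one, fun q _ => List.nil_prefix⟩ (fun _ u => ⟨u.1 ++ [k u], hk u⟩) n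
  have hU : ∀ n, (U n).1 = (List.range n).map fun m => k (U m) := by
    intro n
    induction n with
    | zero => rfl
    | succ n ih =>
      rw [List.range_succ, List.map_append, ← ih]
      rfl
  refine ⟨fun n => k (U n), fun n => ?_⟩
  obtain ⟨a, b, hab, h⟩ := (U n).2
  exact ⟨a, by rw [← hU]; exact h a ⟨le_rfl, hab.le⟩⟩

/-- The sequence of natural numbers labelling a signed sequence. -/
def labels (l : List ℤ) : List ℕ := l.map fun a => a.natAbs - 1

/-- The doubled traversal of a tree contains a copy of `ℚ` iff the tree has an infinite branch. -/
theorem embLE_rat_labels_iff {T : Set (List ℕ)} (hT : ∀ s t, s <+: t → t ∈ T → s ∈ T) :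
    EmbLE ℚ {l : SignedList | labels l.1 ∈ T} ↔ ∃ y : ℕ → ℕ, ∀ n, (List.range n).map y ∈ T := by
  constructor
  · intro h
    obtain ⟨e, he⟩ := h.exists_strictMono
    obtain ⟨k, hk⟩ := exists_branch_of_strictMono (e := fun q => (e q).1) he
    refine ⟨fun n => (k n).natAbs - 1, fun n => ?_⟩
    obtain ⟨q, hq⟩ := hk n
    refine hT _ _ ?_ (e q).2
    have := hq.map fun a => a.natAbs - 1
    rwa [List.map_map] at this
  · rintro ⟨y, hy⟩
    -- These are the signed versions of the initial segments of the branch; each has the two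
    -- children `±(y n + 1)`, where `n` is its length.
    let S : Set SignedList := {l | labels l.1 = (List.range l.1.length).map y}
    have hchild : ∀ l ∈ S, ∀ (a : ℤ) (ha : a ≠ 0), a.natAbs - 1 = y l.1.length →
        l.child a ha ∈ S := by
      intro l hl a ha h
      have hl' : labels l.1 = (List.range l.1.length).map y := hl
      show labels (l.1 ++ [a]) = (List.range (l.1 ++ [a]).length).map y
      rw [List.length_append, List.length_singleton, List.range_succ, List.map_append, ← hl',
        labels, labels, List.map_append]
      simp [h]
    have : EmbLE ℚ S := by
      refine embLE_rat_of_children ⟨⟨[], by simp⟩, rfl⟩ (fun l hl => ?_) fun l hl => ?_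
      · exact ⟨y l.1.length + 1, by omega, by omega, hchild l hl _ _ (by omega)⟩
      · exact ⟨-(y l.1.length + 1), by omega, by omega, hchild l hl _ _ (by omega)⟩
    refine this.trans (embLE_of_strictMono
      (f := fun l : S => (⟨l.1, ?_⟩ : {l : SignedList | labels l.1 ∈ T})) fun _ _ h => h)
    show labels l.1.1 ∈ T
    have hl : labels l.1.1 = _ := l.2
    rw [hl]
    exact hy _

end SignedList

/-! ### Hardness -/

/-- A non-empty analytic subset of a zero-dimensional Polish space is given by a continuous family
of trees: it consists of the points whose tree has an infinite branch. -/
theorem exists_clopen_scheme {X : Type*} [TopologicalSpace X] [SecondCountableTopology X]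
    [T2Space X]
    (hX : TopologicalSpace.IsTopologicalBasis {s : Set X | IsClopen s})
    {g : (ℕ → ℕ) → X} (hg : Continuous g) :
    ∃ C : List ℕ → Set X, (∀ s, IsClopen (C s)) ∧ C [] = Set.univ ∧
      (∀ s t, s <+: t → C t ⊆ C s) ∧
      ∀ x, x ∈ Set.range g ↔ ∃ y : ℕ → ℕ, ∀ n, x ∈ C ((List.range n).map y) := by
  classical
  obtain ⟨B, hBsub, hBc, hB⟩ := hX.exists_countable
  have hBne : (insert ∅ B).Nonempty := Set.insert_nonempty _ _
  obtain ⟨U, hU⟩ := (hBc.insert ∅).exists_eq_range hBne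
  have hUclopen : ∀ i, IsClopen (U i) := by
    intro i
    have : U i ∈ insert ∅ B := hU ▸ Set.mem_range_self i
    rcases this with h | h
    · rw [h]
      exact isClopen_empty
    · exact hBsub h
  let N : List ℕ → Set (ℕ → ℕ) := fun s => {y | s <+: (List.range s.length).map y}
  -- The stage `s` rejects the points of `U i` once `g` is known to keep the whole cylinder of `s`
  -- off `U i`. The bound `i < s.length` leaves finitely many conditions, so `C s` is clopen.
  let bad : List ℕ → Set ℕ := fun s => {i | i < s.length ∧ ∀ y ∈ N s, g y ∉ U i}
  have hN : ∀ {s y}, y ∈ N s ↔ ∀ i (h : i < s.length), s[i] = y i := by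
    intro s y
    constructor
    · intro h i hi
      have := h.eq_of_length (by simp)
      rw [List.getElem_of_eq this hi]
      simp
    · intro h
      have : s = (List.range s.length).map y := List.ext_getElem (by simp) fun i h1 h2 => by
        simp [h i h1]
      exact ⟨[], by rw [List.append_nil]; exact this⟩
  have hNmono : ∀ {s t}, s <+: t → N t ⊆ N s := by
    intro s t hst y hy
    rw [hN] at hy ⊢
    intro i hi
    rw [← hy i (hi.trans_le hst.length_le)]
    exact hst.getElem hi
  refine ⟨fun s => ⋂ i ∈ bad s, (U i)ᶜ, fun s => ?_, ?_, fun s t hst => ?_, fun x => ?_⟩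
  · have hfin : (bad s).Finite := (Set.finite_lt_nat s.length).subset fun i hi => hi.1
    exact hfin.isClopen_biInter fun i _ => (hUclopen i).compl
  · simp [bad]
  · refine Set.biInter_subset_biInter_left fun i hi => ?_
    exact ⟨hi.1.trans_le hst.length_le, fun y hy => hi.2 y (hNmono hst hy)⟩
  · have hmem : ∀ (y : ℕ → ℕ) n, y ∈ N ((List.range n).map y) := fun y n => hN.2 (by simp)
    constructor
    · rintro ⟨y, rfl⟩
      refine ⟨y, fun n => Set.mem_iInter₂.2 fun i hi => hi.2 y (hmem y n)⟩
    · rintro ⟨y, hy⟩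
      refine ⟨y, ?_⟩
      by_contra hne
      obtain ⟨V, hV, hxV, hVsub⟩ := hB.exists_subset_of_mem_open
        (show x ∈ ({g y}ᶜ : Set X) from fun h => hne h.symm) isOpen_compl_singleton
      obtain ⟨i, rfl⟩ : V ∈ Set.range U := hU ▸ Set.mem_insert_of_mem _ hV
      have hopen : IsOpen (g ⁻¹' (U i)ᶜ) := (hUclopen i).compl.isOpen.preimage hg
      have hymem : y ∈ g ⁻¹' (U i)ᶜ := fun h => hVsub h rfl
      obtain ⟨I, u, hu, hsub⟩ := isOpen_pi_iff.1 hopen y hymem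
      -- The initial segment must be longer than `i` for `U i` to be tested, and must include the
      -- finitely many coordinates that keep `g` off `U i`.
      let n := max (i + 1) (I.sup id + 1)
      refine Set.mem_iInter₂.1 (hy n) i ⟨?_, fun z hz => ?_⟩ hxV
      · simp only [List.length_map, List.length_range, n]
        omega
      · refine hsub fun j hj => ?_
        have hjn : j < n := by
          have : id j ≤ I.sup id := Finset.le_sup hj
          simp only [n, id] at this ⊢
          omega
        have := hN.1 hz j (by simpa using hjn)
        simp only [List.getElem_map, List.getElem_range] at this
        exact this ▸ (hu j hj).2

/-- The set of non-scattered orders is `Σ¹₁`-hard. -/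
theorem sigma11Hard_compl_Scat : Sigma11Hard (Scatᶜ : Set Lin) := by
  intro X _ _ hX A hA
  rw [MeasureTheory.AnalyticSet] at hA
  rcases hA with rfl | ⟨g, hg, rfl⟩
  · let L : Lin := Lin.copy (fun _ : Unit => 0) fun _ _ _ => rfl
    refine ⟨fun _ => L, continuous_const, fun x => iff_of_false id (not_not.2 ?_)⟩
    rintro ⟨f, -, hf⟩
    obtain ⟨i⟩ := Lin.nonempty_orderIso_copy (fun _ : Unit => 0) fun _ _ _ => rfl
    exact zero_ne_one (hf (i.symm.injective (Subsingleton.elim (i.symm (f 0)) (i.symm (f 1)))))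
  · obtain ⟨C, hC, hC0, hCmono, hCmem⟩ := exists_clopen_scheme hX hg
    obtain ⟨c, hc⟩ := Countable.exists_injective_nat SignedList
    let S : X → Set SignedList := fun x => {l | SignedList.labels l.1 ∈ {s | x ∈ C s}}
    have hne : ∀ x, Nonempty (S x) := fun x => ⟨⟨⟨[], by simp⟩, by
      show x ∈ C []
      rw [hC0]
      trivial⟩⟩
    have hcS : ∀ x, Function.Injective fun l : S x => c l.1 := fun x l l' h =>
      Subtype.ext (hc h)
    refine ⟨fun x => Lin.copy _ (hcS x), Lin.continuous_of_forall_isClopen fun p => ?_,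
      fun x => ?_⟩
    · by_cases h : ∃ l l' : SignedList, c l = p.1 ∧ c l' = p.2 ∧ l ≤ l'
      · obtain ⟨l, l', hl, hl', hle⟩ := h
        convert (hC (SignedList.labels l.1)).inter (hC (SignedList.labels l'.1)) using 1
        ext x
        refine (Lin.copy_apply_eq_true _ _ _).trans ⟨?_, ?_⟩
        · rintro ⟨a, b, ha, hb, -⟩
          exact ⟨hc (ha.trans hl.symm) ▸ a.2, hc (hb.trans hl'.symm) ▸ b.2⟩
        · rintro ⟨ha, hb⟩
          exact ⟨⟨l, ha⟩, ⟨l', hb⟩, hl, hl', hle⟩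
      · convert isClopen_empty using 1
        refine Set.eq_empty_of_forall_notMem fun x hx => h ?_
        obtain ⟨a, b, ha, hb, hab⟩ := (Lin.copy_apply_eq_true _ _ _).1 hx
        exact ⟨a.1, b.1, ha, hb, hab⟩
    · obtain ⟨i⟩ := Lin.nonempty_orderIso_copy _ (hcS x)
      refine (hCmem x).trans ((SignedList.embLE_rat_labels_iff (T := {s | x ∈ C s})
        fun s t hst ht => hCmono s t hst ht).symm.trans ?_)
      refine ⟨fun h => not_not.2 (h.trans i.embLE), fun h => (not_not.1 h).trans i.symm.embLE⟩

theorem Sigma11Hard.of_reduces {Y Z : Type*} [TopologicalSpace Y] [TopologicalSpace Z] {B : Set Y}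
    {D : Set Z} (hB : Sigma11Hard B) {f : Y → Z} (hf : Reduces f B D) : Sigma11Hard D := by
  intro X _ _ hX A hA
  obtain ⟨h, hh, hh'⟩ := hB X hX A hA
  exact ⟨f ∘ h, hf.1.comp hh, fun x => (hh' x).trans (hf.2 _)⟩

/-! ### Effectivity -/

/-- A union of basic open sets enumerated by a primitive recursive relation. -/
def IsPrimrecUnion (U : Set ((ℕ × ℕ → Bool) × (ℕ → ℕ))) : Prop :=
  ∃ R : ℕ → Condition → Prop, PrimrecRel R ∧ U = {z | ∃ c, (∃ n, R n c) ∧ z ∈ basicOpen c}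

theorem IsPrimrecUnion.union {U V : Set ((ℕ × ℕ → Bool) × (ℕ → ℕ))} (hU : IsPrimrecUnion U)
    (hV : IsPrimrecUnion V) : IsPrimrecUnion (U ∪ V) := by
  obtain ⟨R, hR, rfl⟩ := hU
  obtain ⟨S, hS, rfl⟩ := hV
  refine ⟨fun n c => R n c ∨ S n c, PrimrecPred.or hR hS, ?_⟩
  ext z
  constructor
  · rintro (⟨c, ⟨n, h⟩, h'⟩ | ⟨c, ⟨n, h⟩, h'⟩)
    · exact ⟨c, ⟨n, Or.inl h⟩, h'⟩
    · exact ⟨c, ⟨n, Or.inr h⟩, h'⟩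
  · rintro ⟨c, ⟨n, h | h⟩, h'⟩
    · exact Or.inl ⟨c, ⟨n, h⟩, h'⟩
    · exact Or.inr ⟨c, ⟨n, h⟩, h'⟩

/-- The index `n` codes the parameter `a`, so that checking whether `n` enumerates `c` is primitive
recursive. -/
theorem isPrimrecUnion_setOf {α : Type} [Denumerable α] {P : α → Prop} (hP : PrimrecPred P)
    {φ : α → Condition} (hφ : Primrec φ) :
    IsPrimrecUnion {z | ∃ a, P a ∧ z ∈ basicOpen (φ a)} := by
  refine ⟨fun n c => P (Denumerable.ofNat α n) ∧ φ (Denumerable.ofNat α n) = c, ?_, ?_⟩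
  · have h : Primrec fun x : ℕ × Condition => Denumerable.ofNat α x.1 :=
      (Primrec.ofNat α).comp Primrec.fst
    exact (hP.comp h).and (Primrec.eq.comp (hφ.comp h) Primrec.snd)
  · ext z
    constructor
    · rintro ⟨a, ha, hz⟩
      exact ⟨φ a, ⟨Encodable.encode a, by simpa using ha⟩, hz⟩
    · rintro ⟨_, ⟨n, hn, rfl⟩, hz⟩
      exact ⟨_, hn, hz⟩

/-- The unbounded search for an index `n` with `R n c` halts exactly on the enumerated conditions.
-/
theorem IsPrimrecUnion.lightfaceSigma01 {U : Set ((ℕ × ℕ → Bool) × (ℕ → ℕ))}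
    (hU : IsPrimrecUnion U) : LightfaceSigma01 U := by
  obtain ⟨R, hR, rfl⟩ := hU
  refine ⟨fun c => ∃ n, R n c, ?_, rfl⟩
  obtain ⟨hdec, hR⟩ := hR
  have : ∀ n c, Decidable (R n c) := fun n c => hdec (n, c)
  have hf : Computable fun x : Condition × ℕ => decide (R x.2 x.1) :=
    (hR.comp (Primrec.pair Primrec.snd Primrec.fst)).to_comp.of_eq fun _ =>
      decide_eq_decide.2 Iff.rfl
  have := (Partrec.rfind
    (Computable.to₂ (f := fun x : Condition × ℕ => decide (R x.2 x.1)) hf).partrec₂).dom_re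
  refine this.of_eq fun c => ?_
  rw [Nat.rfind_dom]
  simp

/-- Numerator and denominator of the positive rational coded by `n`. -/
def posRat (n : ℕ) : ℚ := ((Nat.unpair n).1 + 1 : ℕ) / ((Nat.unpair n).2 + 1 : ℕ)

theorem posRat_le_iff (a b : ℕ) : posRat a ≤ posRat b ↔
    ((Nat.unpair a).1 + 1) * ((Nat.unpair b).2 + 1) ≤
      ((Nat.unpair b).1 + 1) * ((Nat.unpair a).2 + 1) := by
  rw [posRat, posRat, div_le_div_iff₀ (by positivity) (by positivity)]
  exact_mod_cast Iff.rfl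

theorem posRat_pos (n : ℕ) : 0 < posRat n := by
  unfold posRat
  positivity

theorem exists_posRat_eq {q : ℚ} (hq : 0 < q) : ∃ n, posRat n = q := by
  refine ⟨Nat.pair (q.num.toNat - 1) (q.den - 1), ?_⟩
  have h1 : 0 < q.num := Rat.num_pos.2 hq
  have h2 := q.den_pos
  rw [posRat, Nat.unpair_pair]
  simp only
  rw [Nat.sub_add_cancel (by omega), Nat.sub_add_cancel (by omega)]
  conv_rhs => rw [← Rat.num_div_den q]
  congr 1
  have : ((q.num.toNat : ℤ)) = q.num := Int.toNat_of_nonneg h1.le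
  exact_mod_cast this

theorem primrecRel_posRat_le : PrimrecRel fun a b => posRat a ≤ posRat b := by
  have h1 : ∀ {f : ℕ × ℕ → ℕ}, Primrec f → Primrec fun x => (Nat.unpair (f x)).1 + 1 := fun hf =>
    Primrec.succ.comp (Primrec.fst.comp (Primrec.unpair.comp hf))
  have h2 : ∀ {f : ℕ × ℕ → ℕ}, Primrec f → Primrec fun x => (Nat.unpair (f x)).2 + 1 := fun hf =>
    Primrec.succ.comp (Primrec.snd.comp (Primrec.unpair.comp hf))
  exact (Primrec.nat_le.comp
    (Primrec.nat_mul.comp (h1 Primrec.fst) (h2 Primrec.snd))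
    (Primrec.nat_mul.comp (h1 Primrec.snd) (h2 Primrec.fst))).of_eq fun x =>
      (posRat_le_iff x.1 x.2).symm

/-- A linear order in `Lin` surjects onto `ℚ` iff it maps monotonically onto the positive
rationals, the map and a section of it being given on codes. -/
theorem epiLE_rat_iff_exists_code (L : Lin) : EpiLE ℚ L.Carrier ↔ ∃ f g : ℕ → ℕ,
    (∀ m n, L.1 (m, n) = true → posRat (f m) ≤ posRat (f n)) ∧
    (∀ k, L.1 (g k, g k) = true) ∧ ∀ k, posRat (f (g k)) = posRat k := by
  -- The positive rationals are isomorphic to `ℚ` and easily coded by pairs of naturals. Supplying a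
  -- section `g` makes surjectivity a closed condition. Codes are not unique, so values of `posRat`
  -- are compared instead.
  have : Nonempty (Set.Ioi (0 : ℚ)) := ⟨⟨1, Set.mem_Ioi.2 one_pos⟩⟩
  obtain ⟨i⟩ := Order.iso_of_countable_dense ℚ (Set.Ioi (0 : ℚ))
  constructor
  · rintro ⟨F, hF, hF'⟩
    choose code hcode using fun q : Set.Ioi (0 : ℚ) => exists_posRat_eq q.2
    choose s hs using hF'
    classical
    -- The default `0` is harmless: monotonicity is only required at related, hence domain, points.
    let f : ℕ → ℕ := fun m => if h : L.1 (m, m) = true then code (i (F ⟨m, h⟩)) else 0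
    have hf : ∀ x : L.Carrier, posRat (f x.1) = i (F x) := fun x => by
      have : f x.1 = code (i (F x)) := dif_pos x.2
      rw [this, hcode]
    refine ⟨f, fun k => (s (i.symm ⟨posRat k, posRat_pos k⟩)).1, fun m n h => ?_, fun k => ?_,
      fun k => ?_⟩
    · have hmn := L.2.field m n h
      let x : L.Carrier := ⟨m, hmn.1⟩
      let x' : L.Carrier := ⟨n, hmn.2⟩
      have h' : x ≤ x' := h
      have h'' : ((i (F x) : ℚ)) ≤ i (F x') := i.monotone (hF h')
      exact (hf x).trans_le (h''.trans_eq (hf x').symm)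
    · exact (s _).2
    · rw [hf, hs, OrderIso.apply_symm_apply]
  · rintro ⟨f, g, hf, hg, hfg⟩
    refine EpiLE.trans i.symm.epiLE ⟨fun x => ⟨posRat (f x.1), posRat_pos _⟩,
      fun x y h => hf x.1 y.1 h, fun q => ?_⟩
    obtain ⟨k, hk⟩ := exists_posRat_eq q.2
    exact ⟨⟨g k, hg k⟩, Subtype.ext ((hfg k).trans hk)⟩

/-- The pairs `(r, y)` such that `r` is not a linear order or `y` is not a code of an epimorphism of
`r` onto the positive rationals. -/
def badCode : Set ((ℕ × ℕ → Bool) × (ℕ → ℕ)) :=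
  {z | ∃ a : ℕ × ℕ × ℕ, True ∧ z ∈ basicOpen ([((a.1, a.2.1), true), ((a.1, a.1), false)], [])} ∪
  {z | ∃ a : ℕ × ℕ × ℕ, True ∧
    z ∈ basicOpen ([((a.1, a.2.1), true), ((a.2.1, a.2.1), false)], [])} ∪
  {z | ∃ a : ℕ × ℕ × ℕ, ¬ a.1 = a.2.1 ∧
    z ∈ basicOpen ([((a.1, a.2.1), true), ((a.2.1, a.1), true)], [])} ∪
  {z | ∃ a : ℕ × ℕ × ℕ, True ∧ z ∈ basicOpen
    ([((a.1, a.2.1), true), ((a.2.1, a.2.2), true), ((a.1, a.2.2), false)], [])} ∪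
  {z | ∃ a : ℕ × ℕ × ℕ, True ∧ z ∈ basicOpen
    ([((a.1, a.1), true), ((a.2.1, a.2.1), true), ((a.1, a.2.1), false), ((a.2.1, a.1), false)],
      [])} ∪
  {z | ∃ a : ℕ × ℕ × ℕ × ℕ, ¬ posRat a.2.2.1 ≤ posRat a.2.2.2 ∧ z ∈ basicOpen
    ([((a.1, a.2.1), true)], [(2 * a.1, a.2.2.1), (2 * a.2.1, a.2.2.2)])} ∪
  {z | ∃ a : ℕ × ℕ × ℕ, True ∧ z ∈ basicOpen
    ([((a.2.1, a.2.1), false)], [(2 * a.1 + 1, a.2.1)])} ∪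
  {z | ∃ a : ℕ × ℕ × ℕ, ¬ (posRat a.2.2 ≤ posRat a.1 ∧ posRat a.1 ≤ posRat a.2.2) ∧
    z ∈ basicOpen ([], [(2 * a.1 + 1, a.2.1), (2 * a.2.1, a.2.2)])}

/-- The even entries of `y` carry the map and the odd ones its section. Quantifying over the
intermediate values, such as the value of the section at `k`, turns each violation into finitely
many prescribed values. -/
theorem notMem_badCode_iff (r : ℕ × ℕ → Bool) (y : ℕ → ℕ) : (r, y) ∉ badCode ↔
    IsLin r ∧ (∀ m n, r (m, n) = true → posRat (y (2 * m)) ≤ posRat (y (2 * n))) ∧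
    (∀ k, r (y (2 * k + 1), y (2 * k + 1)) = true) ∧
    ∀ k, posRat (y (2 * y (2 * k + 1))) = posRat k := by
  have hmem : (r, y) ∉ badCode ↔
      (∀ m n, r (m, n) = true → r (m, m) = true) ∧
      (∀ m n, r (m, n) = true → r (n, n) = true) ∧
      (∀ m n, r (m, n) = true → r (n, m) = true → m = n) ∧
      (∀ k m n, r (k, m) = true → r (m, n) = true → r (k, n) = true) ∧
      (∀ m n, r (m, m) = true → r (n, n) = true → r (m, n) = true ∨ r (n, m) = true) ∧
      (∀ m n, r (m, n) = true → posRat (y (2 * m)) ≤ posRat (y (2 * n))) ∧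
      (∀ k, r (y (2 * k + 1), y (2 * k + 1)) = true) ∧
      ∀ k, posRat (y (2 * y (2 * k + 1))) = posRat k := by
    simp only [badCode, basicOpen, Set.mem_union, Set.mem_ofPred_eq, not_or, List.forall_mem_cons,
      List.not_mem_nil, false_imp_iff, implies_true, and_true, true_and, and_assoc, not_exists,
      Prod.forall]
    constructor
    · rintro ⟨h1, h2, h3, h4, h5, h6, h7, h8⟩
      refine ⟨fun m n h => ?_, fun m n h => ?_, fun m n h h' => ?_, fun k m n h h' => ?_,
        fun m n h h' => ?_, fun m n h => ?_, fun k => ?_, fun k => ?_⟩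
      · exact Bool.eq_true_of_not_eq_false fun h' => h1 m n 0 ⟨h, h'⟩
      · exact Bool.eq_true_of_not_eq_false fun h' => h2 m n 0 ⟨h, h'⟩
      · exact by_contra fun hne => h3 m n 0 ⟨hne, h, h'⟩
      · exact Bool.eq_true_of_not_eq_false fun h'' => h4 k m n ⟨h, h', h''⟩
      · have := h5 m n 0
        rw [not_and, not_and, not_and] at this
        rcases hmn : r (m, n) with _ | _
        · exact Or.inr (Bool.eq_true_of_not_eq_false (this h h' hmn))
        · exact Or.inl rfl
      · exact not_not.1 fun hlt => h6 m n _ _ ⟨hlt, h, rfl, rfl⟩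
      · exact Bool.eq_true_of_not_eq_false fun h' => h7 k _ 0 ⟨h', rfl⟩
      · exact by_contra fun hne => h8 k _ _ ⟨fun h => hne (le_antisymm h.1 h.2), rfl, rfl⟩
    · rintro ⟨h1, h2, h3, h4, h5, h6, h7, h8⟩
      refine ⟨?_, ?_, ?_, ?_, ?_, ?_, ?_, ?_⟩
      · rintro m n - ⟨h, h'⟩
        simp [h1 m n h] at h'
      · rintro m n - ⟨h, h'⟩
        simp [h2 m n h] at h'
      · rintro m n - ⟨hne, h, h'⟩
        exact hne (h3 m n h h')
      · rintro k m n ⟨h, h', h''⟩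
        simp [h4 k m n h h'] at h''
      · rintro m n - ⟨h, h', h'', h'''⟩
        simpa [h'', h'''] using h5 m n h h'
      · rintro m n _ _ ⟨hlt, h, rfl, rfl⟩
        exact hlt (h6 m n h)
      · rintro k _ - ⟨h, rfl⟩
        simp [h7 k] at h
      · rintro k _ _ ⟨hne, rfl, rfl⟩
        exact hne ⟨(h8 k).le, (h8 k).ge⟩
  rw [hmem]
  constructor
  · rintro ⟨h1, h2, h3, h4, h5, h6, h7, h8⟩
    -- Non-emptiness is not tested by `badCode`; the section at `0` supplies a point.
    exact ⟨⟨⟨_, h7 0⟩, fun m n h => ⟨h1 m n h, h2 m n h⟩, h3, h4, h5⟩, h6, h7, h8⟩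
  · rintro ⟨h, h6, h7, h8⟩
    exact ⟨fun m n h' => (h.field m n h').1, fun m n h' => (h.field m n h').2, h.antisymm, h.trans,
      h.total, h6, h7, h8⟩

theorem _root_.Primrec.cons {α β : Type*} [Primcodable α] [Primcodable β] {l : α → List β}
    (hl : Primrec l) {f : α → β} (hf : Primrec f) : Primrec fun a => f a :: l a :=
  Primrec.list_cons.comp hf hl

theorem _root_.Primrec.entry {α : Type*} [Primcodable α] {f g : α → ℕ} (hf : Primrec f)
    (hg : Primrec g) (b : Bool) : Primrec fun a => ((f a, g a), b) :=
  (hf.pair hg).pair (Primrec.const b)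

theorem lightfaceSigma01_badCode : LightfaceSigma01 badCode := by
  have c0 : Primrec fun a : ℕ × ℕ × ℕ => a.1 := Primrec.fst
  have c1 : Primrec fun a : ℕ × ℕ × ℕ => a.2.1 := Primrec.fst.comp Primrec.snd
  have c2 : Primrec fun a : ℕ × ℕ × ℕ => a.2.2 := Primrec.snd.comp Primrec.snd
  have d0 : Primrec fun a : ℕ × ℕ × ℕ × ℕ => a.1 := Primrec.fst
  have d1 : Primrec fun a : ℕ × ℕ × ℕ × ℕ => a.2.1 := Primrec.fst.comp Primrec.snd
  have d2 : Primrec fun a : ℕ × ℕ × ℕ × ℕ => a.2.2.1 :=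
    Primrec.fst.comp (Primrec.snd.comp Primrec.snd)
  have d3 : Primrec fun a : ℕ × ℕ × ℕ × ℕ => a.2.2.2 :=
    Primrec.snd.comp (Primrec.snd.comp Primrec.snd)
  have nil : ∀ (β : Type) [Primcodable β], Primrec fun _ : ℕ × ℕ × ℕ => ([] : List β) :=
    fun _ _ => Primrec.const _
  have nil' : ∀ (β : Type) [Primcodable β], Primrec fun _ : ℕ × ℕ × ℕ × ℕ => ([] : List β) :=
    fun _ _ => Primrec.const _
  have htrue : PrimrecPred fun _ : ℕ × ℕ × ℕ => True := ⟨inferInstance, Primrec.const _⟩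
  refine IsPrimrecUnion.lightfaceSigma01 ?_
  refine IsPrimrecUnion.union (IsPrimrecUnion.union (IsPrimrecUnion.union (IsPrimrecUnion.union
    (IsPrimrecUnion.union (IsPrimrecUnion.union (IsPrimrecUnion.union ?_ ?_) ?_) ?_) ?_) ?_) ?_) ?_
  · exact isPrimrecUnion_setOf htrue
      ((((nil _).cons (c0.entry c0 false)).cons (c0.entry c1 true)).pair (nil _))
  · exact isPrimrecUnion_setOf htrue
      ((((nil _).cons (c1.entry c1 false)).cons (c0.entry c1 true)).pair (nil _))
  · exact isPrimrecUnion_setOf (Primrec.eq.comp c0 c1).not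
      ((((nil _).cons (c1.entry c0 true)).cons (c0.entry c1 true)).pair (nil _))
  · exact isPrimrecUnion_setOf htrue
      (((((nil _).cons (c0.entry c2 false)).cons (c1.entry c2 true)).cons
        (c0.entry c1 true)).pair (nil _))
  · exact isPrimrecUnion_setOf htrue
      ((((((nil _).cons (c1.entry c0 false)).cons (c0.entry c1 false)).cons
        (c1.entry c1 true)).cons (c0.entry c0 true)).pair (nil _))
  · exact isPrimrecUnion_setOf (primrecRel_posRat_le.comp d2 d3).not
      (((nil' _).cons (d0.entry d1 true)).pair
        (((nil' _).cons ((Primrec.nat_double.comp d1).pair d3)).cons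
          ((Primrec.nat_double.comp d0).pair d2)))
  · exact isPrimrecUnion_setOf htrue
      (((nil _).cons (c1.entry c1 false)).pair
        ((nil _).cons ((Primrec.nat_double_succ.comp c0).pair c1)))
  · exact isPrimrecUnion_setOf
      ((primrecRel_posRat_le.comp c2 c0).and (primrecRel_posRat_le.comp c0 c2)).not
      ((nil _).pair (((nil _).cons ((Primrec.nat_double.comp c1).pair c2)).cons
        ((Primrec.nat_double_succ.comp c0).pair c1)))

theorem image_StS_diff_Scat_eq :
    Subtype.val '' (StS \ Scat) = {r | ∃ y, (r, y) ∈ badCodeᶜ} := by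
  ext r
  constructor
  · rintro ⟨L, hL, rfl⟩
    rw [mem_StS_diff_Scat_iff, epiLE_rat_iff_exists_code] at hL
    obtain ⟨f, g, h1, h2, h3⟩ := hL
    let y : ℕ → ℕ := fun n => if n % 2 = 0 then f (n / 2) else g (n / 2)
    have hy0 : ∀ m, y (2 * m) = f m := fun m => by simp [y]
    have hy1 : ∀ m, y (2 * m + 1) = g m := fun m => by
      have : (2 * m + 1) / 2 = m := by omega
      simp [y, this]
    refine ⟨y, (notMem_badCode_iff _ _).2 ?_⟩
    simp only [hy0, hy1]
    exact ⟨L.2, h1, h2, h3⟩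
  · rintro ⟨y, hy⟩
    obtain ⟨hr, h1, h2, h3⟩ := (notMem_badCode_iff _ _).1 hy
    refine ⟨⟨r, hr⟩, ?_, rfl⟩
    rw [mem_StS_diff_Scat_iff, epiLE_rat_iff_exists_code]
    exact ⟨fun m => y (2 * m), fun k => y (2 * k + 1), h1, h2, h3⟩

theorem lightfaceSigma11_StS_diff_Scat : LightfaceSigma11 (Subtype.val '' (StS \ Scat)) :=
  ⟨badCodeᶜ, by rw [compl_compl]; exact lightfaceSigma01_badCode, image_StS_diff_Scat_eq⟩

theorem isOpen_basicOpen (c : Condition) : IsOpen (basicOpen c) := by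
  have h1 : IsOpen (⋂ p ∈ {p | p ∈ c.1}, {z : (ℕ × ℕ → Bool) × (ℕ → ℕ) | z.1 p.1 = p.2}) :=
    (List.finite_toSet c.1).isOpen_biInter fun p _ =>
      (isOpen_discrete {p.2}).preimage (f := fun z : (ℕ × ℕ → Bool) × (ℕ → ℕ) => z.1 p.1)
        ((continuous_apply p.1).comp continuous_fst)
  have h2 : IsOpen (⋂ p ∈ {p | p ∈ c.2}, {z : (ℕ × ℕ → Bool) × (ℕ → ℕ) | z.2 p.1 = p.2}) :=
    (List.finite_toSet c.2).isOpen_biInter fun p _ =>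
      (isOpen_discrete {p.2}).preimage (f := fun z : (ℕ × ℕ → Bool) × (ℕ → ℕ) => z.2 p.1)
        ((continuous_apply p.1).comp continuous_snd)
  convert h1.inter h2 using 1
  ext z
  simp [basicOpen]

theorem LightfaceSigma01.isOpen {U : Set ((ℕ × ℕ → Bool) × (ℕ → ℕ))} (hU : LightfaceSigma01 U) :
    IsOpen U := by
  obtain ⟨E, -, rfl⟩ := hU
  have : {z | ∃ c, E c ∧ z ∈ basicOpen c} = ⋃ c, ⋃ (_ : E c), basicOpen c := by
    ext z
    simp
  rw [this]
  exact isOpen_iUnion fun c => isOpen_iUnion fun _ => isOpen_basicOpen c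

/-- A lightface `Σ¹₁` set of linear orders is analytic in the space of linear orders. -/
theorem LightfaceSigma11.analyticSet {B : Set Lin} (hB : LightfaceSigma11 (Subtype.val '' B)) :
    MeasureTheory.AnalyticSet B := by
  obtain ⟨F, hF, h⟩ := hB
  have hcl : IsClosed F := ⟨hF.isOpen⟩
  have : PolishSpace (ℕ × ℕ → Bool) := {}
  have : PolishSpace (ℕ → ℕ) := {}
  have := hcl.polishSpace
  have hmem : ∀ z : F, ∃ hz : IsLin z.1.1, (⟨z.1.1, hz⟩ : Lin) ∈ B := by
    intro z
    have hz : z.1.1 ∈ Subtype.val '' B := by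
      rw [h]
      exact ⟨z.1.2, z.2⟩
    obtain ⟨L, hL, hLz⟩ := hz
    exact ⟨hLz ▸ L.2, by convert hL; exact hLz.symm⟩
  -- The projection of the Polish space `F` takes values in `B`, so it is a continuous map into
  -- `Lin` with range `B`.
  let φ : F → Lin := fun z => ⟨z.1.1, (hmem z).1⟩
  have hφ : Continuous φ := Continuous.subtype_mk (continuous_fst.comp continuous_subtype_val) _
  have hrange : Set.range φ = B := by
    ext L
    constructor
    · rintro ⟨z, rfl⟩
      exact (hmem z).2
    · intro hL
      have : L.1 ∈ {x | ∃ y, (x, y) ∈ F} := h ▸ Set.mem_image_of_mem _ hL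
      obtain ⟨y, hy⟩ := this
      exact ⟨⟨_, hy⟩, rfl⟩
  rw [← hrange]
  exact MeasureTheory.analyticSet_range_of_polishSpace hφ

theorem reduces_etaAddMulOmega_StS : Reduces Lin.etaAddMulOmega Scatᶜ StS :=
  ⟨Lin.continuous_etaAddMulOmega, mem_compl_Scat_iff_etaAddMulOmega_mem_StS⟩

theorem reduces_etaAddMulOmega_StS_diff_Scat : Reduces Lin.etaAddMulOmega Scatᶜ (StS \ Scat) :=
  ⟨Lin.continuous_etaAddMulOmega, mem_compl_Scat_iff_etaAddMulOmega⟩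

end LinOrd

theorem mainTheorem5 :
    LinOrd.Sigma11Hard LinOrd.StS ∧
    LinOrd.LightfaceSigma11 (Subtype.val '' (LinOrd.StS \ LinOrd.Scat)) ∧
    LinOrd.Sigma11Complete (LinOrd.StS \ LinOrd.Scat) ∧
    LinOrd.Reduces LinOrd.Lin.etaAddMulOmega LinOrd.Scatᶜ LinOrd.StS ∧
    LinOrd.Reduces LinOrd.Lin.etaAddMulOmega LinOrd.Scatᶜ (LinOrd.StS \ LinOrd.Scat) :=
  ⟨LinOrd.sigma11Hard_compl_Scat.of_reduces LinOrd.reduces_etaAddMulOmega_StS,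
    LinOrd.lightfaceSigma11_StS_diff_Scat,
    ⟨LinOrd.lightfaceSigma11_StS_diff_Scat.analyticSet,
      LinOrd.sigma11Hard_compl_Scat.of_reduces LinOrd.reduces_etaAddMulOmega_StS_diff_Scat⟩,
    LinOrd.reduces_etaAddMulOmega_StS, LinOrd.reduces_etaAddMulOmega_StS_diff_Scat⟩
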